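/- Let $d_1,d_2\ge 0$ be integers. Identify $\mathbb R^{d_1\times d_2}$ with the Euclidean space of dimension $d_1d_2$, with inner product $\langle X,Y\rangle=\operatorname{tr}(X^{\mathsf T}Y)$ and Frobenius norm $\|X\|_F=(\sum_{i,j}|X_{ij}|^2)^{1/2}$. Let $\|X\|_*=\sum_{i=1}^{\min(d_1,d_2)}s_i(X)$ be the nuclear norm of $X$, where $s_1(X)\ge s_2(X)\ge\cdots\ge 0$ are its singular values. For a bounded set $K\subset\mathbb R^{d_1\times d_2}$, the Gaussian mean width of $K$ is $$w(K)=\mathbb E\sup_{U\in K-K}\langle G,U\rangle,\qquad K-K=\{X-Y:\ X,Y\in K\},$$ where $G$ is a random $d_1\times d_2$ matrix with independent $N(0,1)$ entries (and $w(\emptyset)=0$). (i) The unit ball $B_*=\{X\in\mathbb R^{d_1\times d_2}:\ \|X\|_*\le 1\}$ is bounded, the random variable $\sup_{U\in B_*-B_*}\langle G,U\rangle$ is integrable, and $$w(B_*)\le 2\left(\sqrt{d_1}+\sqrt{d_2}\right).$$ (ii) For every integer $r\ge 0$, the set $D=\{X\in\mathbb R^{d_1\times d_2}:\ \|X\|_F=1,\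 \operatorname{rank}(X)\le r\}$ is bounded, the random variable $\sup_{U\in D-D}\langle G,U\rangle$ is integrable, and $$w(D)\le 2\sqrt{2r(d_1+d_2)}.$$ -/

import Mathlib

noncomputable section

namespace GaussianWidth

open MeasureTheory ProbabilityTheory
open scoped Pointwise

/-- The width of `K ⊆ ℝ^ι` in the direction of an arbitrary vector `g`:
`sup_{u ∈ K - K} ⟨g, u⟩`. The supremum is real-valued, and is meaningful for bounded `K`
(for `K = ∅` it is `0` by convention). -/
def directionalWidth {ι : Type*} [Fintype ι] (K : Set (EuclideanSpace ℝ ι))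
    (g : EuclideanSpace ℝ ι) : ℝ :=
  ⨆ u : ↥(K - K), inner ℝ g (u : EuclideanSpace ℝ ι)

/-- The Gaussian mean width `w(K) = E sup_{u ∈ K - K} ⟨g, u⟩` of a bounded set `K ⊆ ℝ^ι`,
where `g` is a standard Gaussian random vector. -/
def gaussianMeanWidth {ι : Type*} [Fintype ι] (K : Set (EuclideanSpace ℝ ι)) : ℝ :=
  ∫ g, directionalWidth K g ∂(stdGaussian (EuclideanSpace ℝ ι))

/-- The identification of `d₁ × d₂` matrices with vectors of the Euclidean space
`ℝ^(d₁ × d₂)`. -/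
def vectorize {d₁ d₂ : ℕ} (X : Matrix (Fin d₁) (Fin d₂) ℝ) :
    EuclideanSpace ℝ (Fin d₁ × Fin d₂) :=
  WithLp.toLp 2 (fun p => X p.1 p.2)

/-- The Euclidean inner product of matrices is `⟨X, Y⟩ = tr (Xᵀ Y)`. -/
theorem inner_vectorize {d₁ d₂ : ℕ} (X Y : Matrix (Fin d₁) (Fin d₂) ℝ) :
    inner ℝ (vectorize X) (vectorize Y) = (X.transpose * Y).trace := by
  simp only [vectorize, PiLp.inner_apply, Fintype.sum_prod_type, Matrix.trace, Matrix.diag,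
    Matrix.mul_apply, Matrix.transpose_apply]
  rw [Finset.sum_comm]
  simp [mul_comm]

/-- The Frobenius norm of a matrix. -/
def frobeniusNorm {d₁ d₂ : ℕ} (X : Matrix (Fin d₁) (Fin d₂) ℝ) : ℝ :=
  Real.sqrt (∑ i, ∑ j, |X i j| ^ 2)

/-- The nuclear norm `‖X‖_* = s_1(X) + ⋯ + s_d(X)`, `d = min(d₁, d₂)`, of a matrix: the sum of
its singular values (Mathlib numbers them from `0` and in decreasing order), where `X` acts as a
linear map from Euclidean `ℝ^{d₂}` to Euclidean `ℝ^{d₁}`. -/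
def nuclearNorm {d₁ d₂ : ℕ} (X : Matrix (Fin d₁) (Fin d₂) ℝ) : ℝ :=
  ∑ k ∈ Finset.range (min d₁ d₂), (Matrix.toEuclideanLin X).singularValues k

/-- The unit ball `B_*` of the nuclear norm, as a subset of `ℝ^(d₁ × d₂)`. -/
def nuclearUnitBall (d₁ d₂ : ℕ) : Set (EuclideanSpace ℝ (Fin d₁ × Fin d₂)) :=
  vectorize '' {X : Matrix (Fin d₁) (Fin d₂) ℝ | nuclearNorm X ≤ 1}

/-- The `d₁ × d₂` matrices of unit Frobenius norm and rank at most `r`, as a subset of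
`ℝ^(d₁ × d₂)`. -/
def lowRankUnitSphere (d₁ d₂ r : ℕ) : Set (EuclideanSpace ℝ (Fin d₁ × Fin d₂)) :=
  vectorize '' {X : Matrix (Fin d₁) (Fin d₂) ℝ | frobeniusNorm X = 1 ∧ X.rank ≤ r}

end GaussianWidth

end

open MeasureTheory ProbabilityTheory

/-! ### Gaussian integration by parts. -/

namespace GaussianWidth

/-! Trace duality gives `|⟨G, X⟩| ≤ ‖X‖_* ‖G‖_op` (`abs_inner_vectorize_le`), so the width of a set
on which `‖X‖_* ≤ C` is at most `2 C E‖G‖_op` (`gaussianMeanWidth_le`). Here `C = 1` for the nuclear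
ball, and `C = √r` for the low-rank sphere by Cauchy-Schwarz on the nonzero singular values.

The probabilistic core is `E‖G‖_op ≤ √d₁ + √d₂`, with no loss of constant. The norm is a supremum of
`⟨u, G v⟩` over unit vectors. This process is compared with `⟨u, g⟩ + ⟨v, h⟩`, where `g`, `h` are
independent Gaussian vectors. The second process has larger increments, the gap between the squared
ones being `2 (1 - ⟨u, u'⟩)(1 - ⟨v, v'⟩) ≥ 0`, and its expected supremum is at most `√d₁ + √d₂`. The
comparison of suprema is Sudakov-Fernique (`integral_sup'_le_of_increments`), used on finite nets:
replace the maximum by log-sum-exp, rotate one process into the other, and see by Gaussian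
integration by parts that the expectation increases. -/

theorem integrable_gaussianReal_iff {f : ℝ → ℝ} :
    Integrable f (gaussianReal 0 1) ↔ Integrable (fun x => gaussianPDFReal 0 1 x * f x) := by
  rw [gaussianReal_of_var_ne_zero _ one_ne_zero,
    integrable_withDensity_iff_integrable_smul' (measurable_gaussianPDF _ _)
      (ae_of_all _ fun _ => gaussianPDF_lt_top)]
  simp [toReal_gaussianPDF]

theorem hasDerivAt_gaussianPDFReal (x : ℝ) :
    HasDerivAt (gaussianPDFReal 0 1) (-x * gaussianPDFReal 0 1 x) x := by
  have h : HasDerivAt (fun y : ℝ => -(y - 0) ^ 2 / (2 * ((1 : NNReal) : ℝ))) (-x) x := by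
    have := (((hasDerivAt_id x).pow 2).neg).div_const (2 : ℝ)
    simp only [sub_zero, NNReal.coe_one, mul_one]
    convert! this using 1
    simp only [id, Nat.cast_ofNat]; ring
  rw [gaussianPDFReal_def]
  convert! h.exp.const_mul ((Real.sqrt (2 * Real.pi * ((1 : NNReal) : ℝ)))⁻¹) using 1
  ring

/-- Gaussian integration by parts on the line. -/
theorem integral_id_mul_gaussianReal {f f' : ℝ → ℝ} (hf : ∀ t, HasDerivAt f (f' t) t)
    (hi : Integrable f (gaussianReal 0 1)) (hi' : Integrable f' (gaussianReal 0 1))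
    (hid : Integrable (fun t => t * f t) (gaussianReal 0 1)) :
    ∫ t, t * f t ∂gaussianReal 0 1 = ∫ t, f' t ∂gaussianReal 0 1 := by
  rw [integrable_gaussianReal_iff] at hi hi' hid
  rw [integral_gaussianReal_eq_integral_smul one_ne_zero,
    integral_gaussianReal_eq_integral_smul one_ne_zero]
  have key := integral_mul_deriv_eq_deriv_mul_of_integrable (u := f) (u' := f')
    (v := gaussianPDFReal 0 1) (v' := fun x => -x * gaussianPDFReal 0 1 x)
    (fun x _ => hf x) (fun x _ => hasDerivAt_gaussianPDFReal x)
    (hid.neg.congr (ae_of_all _ fun x => by simp only [Pi.neg_apply, Pi.mul_apply]; ring))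
    (hi'.congr (ae_of_all _ fun x => by simp only [Pi.mul_apply]; ring))
    (hi.congr (ae_of_all _ fun x => by simp only [Pi.mul_apply]; ring))
  simp only [smul_eq_mul]
  calc ∫ x, gaussianPDFReal 0 1 x * (x * f x)
      = -∫ x, f x * (-x * gaussianPDFReal 0 1 x) := by
        rw [← integral_neg]; congr 1; ext x; ring
    _ = ∫ x, gaussianPDFReal 0 1 x * f' x := by
        rw [key, neg_neg]; congr 1; ext x; ring

/-- The law of a family of independent standard Gaussian variables indexed by `κ`. -/
noncomputable def gaussianPi (κ : Type*) [Fintype κ] : Measure (κ → ℝ) :=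
  Measure.pi fun _ => gaussianReal 0 1

variable {κ : Type*} [Fintype κ]

instance : IsProbabilityMeasure (gaussianPi κ) := by
  unfold gaussianPi; infer_instance

theorem measurePreserving_eval_gaussianPi (k : κ) :
    MeasurePreserving (fun x : κ → ℝ => x k) (gaussianPi κ) (gaussianReal 0 1) :=
  measurePreserving_eval _ k

/-- Resampling one coordinate does not change the law. -/
theorem measurePreserving_update_gaussianPi [DecidableEq κ] (k : κ) :
    MeasurePreserving (fun p : (κ → ℝ) × ℝ => Function.update p.1 k p.2)
      ((gaussianPi κ).prod (gaussianReal 0 1)) (gaussianPi κ) := by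
  have hm : Measurable (fun p : (κ → ℝ) × ℝ => Function.update p.1 k p.2) := by
    refine measurable_pi_iff.2 fun j => ?_
    by_cases h : j = k
    · subst h; simpa using measurable_snd
    · simp only [Function.update_of_ne h]; fun_prop
  refine ⟨hm, ?_⟩
  symm
  refine Measure.pi_eq fun s hs => ?_
  rw [Measure.map_apply hm (MeasurableSet.univ_pi hs)]
  have : (fun p : (κ → ℝ) × ℝ => Function.update p.1 k p.2) ⁻¹' Set.univ.pi s =
      (Set.univ.pi (Function.update s k Set.univ)) ×ˢ s k := by
    ext ⟨x, t⟩
    simp only [Set.mem_preimage, Set.mem_pi, Set.mem_univ, forall_true_left, Set.mem_prod]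
    constructor
    · intro h
      refine ⟨fun j => ?_, by simpa using h k⟩
      by_cases hj : j = k
      · subst hj; simp
      · simpa [hj] using h j
    · rintro ⟨h, ht⟩ j
      by_cases hj : j = k
      · subst hj; simpa using ht
      · simpa [hj] using h j
  rw [this, Measure.prod_prod, gaussianPi, Measure.pi_pi,
    ← Finset.mul_prod_erase _ _ (Finset.mem_univ k), Finset.prod_congr rfl
      (g := fun j => gaussianReal 0 1 (s j)) fun j hj => ?_]
  · simp [← Finset.mul_prod_erase _ _ (Finset.mem_univ k), mul_comm]
  · rw [Function.update_of_ne (Finset.ne_of_mem_erase hj)]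

/-- Gaussian integration by parts in one coordinate. -/
theorem integral_coord_mul_gaussianPi [DecidableEq κ] (k : κ) {F F' : (κ → ℝ) → ℝ}
    (hF : ∀ x t, HasDerivAt (fun s => F (Function.update x k s)) (F' (Function.update x k t)) t)
    (hi : Integrable F (gaussianPi κ)) (hi' : Integrable F' (gaussianPi κ))
    (hid : Integrable (fun x => x k * F x) (gaussianPi κ)) :
    ∫ x, x k * F x ∂gaussianPi κ = ∫ x, F' x ∂gaussianPi κ := by
  have hU := measurePreserving_update_gaussianPi k
  have lift : ∀ {H : (κ → ℝ) → ℝ}, Integrable H (gaussianPi κ) →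
      Integrable (fun p : (κ → ℝ) × ℝ => H (Function.update p.1 k p.2))
        ((gaussianPi κ).prod (gaussianReal 0 1)) := fun h => hU.integrable_comp_of_integrable h
  -- Resampling coordinate `k` preserves the law, so Fubini isolates that variable and reduces the
  -- claim to the line.
  have fub : ∀ {H : (κ → ℝ) → ℝ}, Integrable H (gaussianPi κ) →
      ∫ x, H x ∂gaussianPi κ =
        ∫ x, ∫ t, H (Function.update x k t) ∂gaussianReal 0 1 ∂gaussianPi κ := by
    intro H h
    rw [← integral_prod _ (lift h)]
    nth_rw 1 [← hU.map_eq]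
    refine integral_map hU.measurable.aemeasurable ?_
    rw [hU.map_eq]; exact h.aestronglyMeasurable
  rw [fub hid, fub hi']
  refine integral_congr_ae ?_
  filter_upwards [(lift hi).prod_right_ae, (lift hi').prod_right_ae, (lift hid).prod_right_ae]
    with x h1 h2 h3
  simp only [Function.update_self] at h3 ⊢
  exact integral_id_mul_gaussianReal (hF x) h1 h2 h3

end GaussianWidth

/-! ### Log-sum-exp and the Sudakov-Fernique comparison. -/

namespace GaussianWidth

variable {T : Type*} [Fintype T]

/-- The log-sum-exp function, a smooth approximation of the maximum. -/
noncomputable def logSumExp (z : T → ℝ) : ℝ := Real.log (∑ i, Real.exp (z i))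

/-- The gradient of `logSumExp`, a probability vector. -/
noncomputable def softmax (z : T → ℝ) (i : T) : ℝ := Real.exp (z i) / ∑ j, Real.exp (z j)

theorem softmax_nonneg (z : T → ℝ) (i : T) : 0 ≤ softmax z i := by
  unfold softmax; positivity

section Nonempty

variable [Nonempty T]

theorem sum_exp_pos (z : T → ℝ) : 0 < ∑ i, Real.exp (z i) :=
  Finset.sum_pos (fun _ _ => Real.exp_pos _) Finset.univ_nonempty

theorem sum_softmax (z : T → ℝ) : ∑ i, softmax z i = 1 := by
  simp only [softmax, ← Finset.sum_div]
  exact div_self (sum_exp_pos z).ne'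

theorem softmax_le_one (z : T → ℝ) (i : T) : softmax z i ≤ 1 := by
  rw [← sum_softmax z]
  exact Finset.single_le_sum (fun j _ => softmax_nonneg z j) (Finset.mem_univ i)

theorem abs_softmax_le_one (z : T → ℝ) (i : T) : |softmax z i| ≤ 1 := by
  rw [abs_of_nonneg (softmax_nonneg z i)]; exact softmax_le_one z i

theorem le_logSumExp (z : T → ℝ) (i : T) : z i ≤ logSumExp z := by
  rw [logSumExp, Real.le_log_iff_exp_le (sum_exp_pos z)]
  exact Finset.single_le_sum (f := fun j => Real.exp (z j))
    (fun j _ => (Real.exp_pos _).le) (Finset.mem_univ i)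

/-- The error `log |T|` does not depend on the size of `z`, so it becomes negligible after
rescaling. -/
theorem logSumExp_le {z : T → ℝ} {m : ℝ} (h : ∀ i, z i ≤ m) :
    logSumExp z ≤ m + Real.log (Fintype.card T) := by
  have hc : (0 : ℝ) < Fintype.card T := by exact_mod_cast Fintype.card_pos
  rw [logSumExp, Real.log_le_iff_le_exp (sum_exp_pos z), Real.exp_add, Real.exp_log hc]
  calc ∑ i, Real.exp (z i) ≤ ∑ _i : T, Real.exp m :=
        Finset.sum_le_sum fun i _ => Real.exp_le_exp.2 (h i)
    _ = Real.exp m * Fintype.card T := by simp [mul_comm]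

theorem abs_logSumExp_le (z : T → ℝ) :
    |logSumExp z| ≤ ∑ i, |z i| + Real.log (Fintype.card T) := by
  have hs : ∀ i, |z i| ≤ ∑ j, |z j| := fun i =>
    Finset.single_le_sum (f := fun j => |z j|) (fun j _ => abs_nonneg _) (Finset.mem_univ i)
  have hc : 0 ≤ Real.log (Fintype.card T) := Real.log_natCast_nonneg _
  obtain ⟨i⟩ := ‹Nonempty T›
  rw [abs_le]
  constructor
  · linarith [le_logSumExp z i, neg_abs_le (z i), hs i]
  · exact logSumExp_le fun i => (le_abs_self _).trans (hs i)

theorem continuous_logSumExp : Continuous (logSumExp : (T → ℝ) → ℝ) := by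
  unfold logSumExp
  exact Continuous.log (by fun_prop) fun z => (sum_exp_pos z).ne'

theorem continuous_softmax (i : T) : Continuous fun z : T → ℝ => softmax z i := by
  unfold softmax
  exact Continuous.div (by fun_prop) (by fun_prop) fun z => (sum_exp_pos z).ne'

theorem hasDerivAt_logSumExp {z : ℝ → T → ℝ} {z' : T → ℝ} {t : ℝ}
    (h : ∀ i, HasDerivAt (fun s => z s i) (z' i) t) :
    HasDerivAt (fun s => logSumExp (z s)) (∑ i, softmax (z t) i * z' i) t := by
  have hs : HasDerivAt (fun s => ∑ i, Real.exp (z s i)) (∑ i, Real.exp (z t i) * z' i) t :=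
    HasDerivAt.fun_sum fun i _ => (h i).exp
  convert! hs.log (sum_exp_pos (z t)).ne' using 1
  rw [Finset.sum_div]
  exact Finset.sum_congr rfl fun i _ => by rw [softmax, div_mul_eq_mul_div]

theorem hasDerivAt_softmax {z : ℝ → T → ℝ} {z' : T → ℝ} {t : ℝ}
    (h : ∀ i, HasDerivAt (fun s => z s i) (z' i) t) (i : T) :
    HasDerivAt (fun s => softmax (z s) i)
      (softmax (z t) i * (z' i - ∑ j, softmax (z t) j * z' j)) t := by
  have hs : HasDerivAt (fun s => ∑ i, Real.exp (z s i)) (∑ i, Real.exp (z t i) * z' i) t :=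
    HasDerivAt.fun_sum fun i _ => (h i).exp
  convert! (h i).exp.div hs (sum_exp_pos (z t)).ne' using 1
  have h0 := (sum_exp_pos (z t)).ne'
  have : ∑ j, softmax (z t) j * z' j
      = (∑ j, Real.exp (z t j) * z' j) / ∑ j, Real.exp (z t j) := by
    rw [Finset.sum_div]
    exact Finset.sum_congr rfl fun i _ => by rw [softmax, div_mul_eq_mul_div]
  rw [this, softmax]
  field_simp

end Nonempty

/-- A covariance is half the mean product of the differences of two independent copies. Through this
identity only the increments of the processes matter. -/
theorem weighted_covariance_eq {p : T → ℝ} (hp : ∑ i, p i = 1) (u w : T → ℝ) :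
    ∑ i, u i * (p i * (w i - ∑ j, p j * w j)) =
      (∑ i, ∑ j, p i * p j * ((u i - u j) * (w i - w j))) / 2 := by
  have e : ∀ i j, p i * p j * ((u i - u j) * (w i - w j)) =
      (p i * u i * w i) * p j + p i * (p j * u j * w j)
        - (p i * u i) * (p j * w j) - (p i * w i) * (p j * u j) := fun i j => by ring
  simp only [e, Finset.sum_add_distrib, Finset.sum_sub_distrib, ← Finset.mul_sum,
    ← Finset.sum_mul, hp]
  have e' : ∀ i, u i * (p i * (w i - ∑ j, p j * w j)) =
      p i * u i * w i - (p i * u i) * ∑ j, p j * w j := fun i => by ring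
  simp only [e', Finset.sum_sub_distrib, ← Finset.sum_mul]
  ring

variable {κ : Type*} [Fintype κ]

theorem integrable_coord_gaussianPi (k : κ) :
    Integrable (fun x : κ → ℝ => x k) (gaussianPi κ) :=
  (measurePreserving_eval_gaussianPi k).integrable_comp_of_integrable
    ((memLp_id_gaussianReal (μ := 0) (v := 1) 1).integrable le_rfl)

theorem integrable_dotProduct_gaussianPi (c : κ → ℝ) :
    Integrable (fun x : κ → ℝ => c ⬝ᵥ x) (gaussianPi κ) :=
  integrable_finsetSum _ fun k _ => (integrable_coord_gaussianPi k).const_mul _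

omit [Fintype T] in
theorem continuous_dotProduct_family (c : T → κ → ℝ) :
    Continuous fun x : κ → ℝ => fun i => c i ⬝ᵥ x := by
  unfold dotProduct; fun_prop

theorem hasDerivAt_dotProduct_update [DecidableEq κ] (c x : κ → ℝ) (k : κ) (t : ℝ) :
    HasDerivAt (fun s => c ⬝ᵥ Function.update x k s) (c k) t := by
  have : (fun s => c ⬝ᵥ Function.update x k s) =
      fun s => c k * s + ∑ j ∈ Finset.univ.erase k, c j * x j := by
    ext s
    rw [dotProduct, ← Finset.add_sum_erase _ _ (Finset.mem_univ k), Function.update_self]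
    congr 1
    exact Finset.sum_congr rfl fun j hj => by
      rw [Function.update_of_ne (Finset.ne_of_mem_erase hj)]
  rw [this]
  simpa using (((hasDerivAt_id t).const_mul (c k)).add_const
    (∑ j ∈ Finset.univ.erase k, c j * x j))

variable [Nonempty T]

theorem integrable_softmax_mul {H : (κ → ℝ) → ℝ} (hH : Integrable H (gaussianPi κ))
    (c : T → κ → ℝ) (i : T) :
    Integrable (fun x => softmax (fun j => c j ⬝ᵥ x) i * H x) (gaussianPi κ) :=
  hH.bdd_mul (c := 1)
    ((continuous_softmax i).comp (continuous_dotProduct_family c)).aestronglyMeasurable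
    (ae_of_all _ fun _ => abs_softmax_le_one _ i)

theorem integrable_softmax (c : T → κ → ℝ) (i : T) :
    Integrable (fun x => softmax (fun j => c j ⬝ᵥ x) i) (gaussianPi κ) := by
  simpa using integrable_softmax_mul (integrable_const (1 : ℝ)) c i

theorem integrable_softmax_partial (c : T → κ → ℝ) (i : T) (k : κ) :
    Integrable (fun x => softmax (fun j => c j ⬝ᵥ x) i *
      (c i k - ∑ j, softmax (fun j => c j ⬝ᵥ x) j * c j k)) (gaussianPi κ) :=
  integrable_softmax_mul ((integrable_const _).sub
    (integrable_finsetSum _ fun j _ => (integrable_softmax c j).mul_const _)) c i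

theorem integral_coord_mul_softmax (c : T → κ → ℝ) (i : T) (k : κ) :
    ∫ x, x k * softmax (fun j => c j ⬝ᵥ x) i ∂gaussianPi κ =
      ∫ x, softmax (fun j => c j ⬝ᵥ x) i *
        (c i k - ∑ j, softmax (fun j => c j ⬝ᵥ x) j * c j k) ∂gaussianPi κ := by
  classical
  refine integral_coord_mul_gaussianPi k
    (F := fun x => softmax (fun j => c j ⬝ᵥ x) i)
    (F' := fun x => softmax (fun j => c j ⬝ᵥ x) i *
        (c i k - ∑ j, softmax (fun j => c j ⬝ᵥ x) j * c j k))
    (fun x t => hasDerivAt_softmax (fun j => hasDerivAt_dotProduct_update (c j) x k t) i)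
    (integrable_softmax c i) (integrable_softmax_partial c i k) ?_
  simpa only [mul_comm] using integrable_softmax_mul (integrable_coord_gaussianPi k) c i

/-- Integration by parts in each coordinate `k` produces the softmax covariance of `d · k` and `c ·
k`. Symmetrizing and summing over `k` leaves the quantities in `h`, with nonnegative weights. -/
theorem integral_softmax_mul_dotProduct_nonneg (c d : T → κ → ℝ)
    (h : ∀ i j, 0 ≤ ∑ k, (d i k - d j k) * (c i k - c j k)) :
    0 ≤ ∫ x, ∑ i, softmax (fun j => c j ⬝ᵥ x) i * (d i ⬝ᵥ x) ∂gaussianPi κ := by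
  have e : ∀ x : κ → ℝ, ∑ i, softmax (fun j => c j ⬝ᵥ x) i * (d i ⬝ᵥ x) =
      ∑ i, ∑ k, d i k * (x k * softmax (fun j => c j ⬝ᵥ x) i) := fun x => by
    refine Finset.sum_congr rfl fun i _ => ?_
    rw [dotProduct, Finset.mul_sum]
    exact Finset.sum_congr rfl fun k _ => by ring
  have hI : ∀ i k, Integrable (fun x : κ → ℝ => d i k * (x k * softmax (fun j => c j ⬝ᵥ x) i))
      (gaussianPi κ) := fun i k => by
    have := (integrable_softmax_mul (integrable_coord_gaussianPi k) c i).const_mul (d i k)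
    simpa only [mul_comm] using this
  simp only [e]
  rw [integral_finsetSum _ fun i _ => integrable_finsetSum _ fun k _ => hI i k]
  simp only [integral_finsetSum _ fun k _ => hI _ k, integral_const_mul,
    integral_coord_mul_softmax]
  simp only [← integral_const_mul]
  have hJ : ∀ i k, Integrable (fun x : κ → ℝ => d i k * (softmax (fun j => c j ⬝ᵥ x) i *
      (c i k - ∑ j, softmax (fun j => c j ⬝ᵥ x) j * c j k))) (gaussianPi κ) :=
    fun i k => (integrable_softmax_partial c i k).const_mul _
  simp only [← integral_finsetSum _ fun k _ => hJ _ k]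
  rw [← integral_finsetSum _ fun i _ => integrable_finsetSum _ fun k _ => hJ i k]
  refine integral_nonneg fun x => ?_
  simp only [Pi.zero_apply]
  rw [Finset.sum_comm]
  set p := softmax fun j => c j ⬝ᵥ x with hp
  have key := fun k => weighted_covariance_eq (sum_softmax fun j => c j ⬝ᵥ x)
    (fun i => d i k) (fun i => c i k)
  simp only [← hp] at key
  rw [Finset.sum_congr rfl fun k _ => key k, ← Finset.sum_div]
  refine div_nonneg ?_ zero_le_two
  rw [Finset.sum_comm]
  refine Finset.sum_nonneg fun i _ => ?_
  rw [Finset.sum_comm]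
  refine Finset.sum_nonneg fun j _ => ?_
  rw [← Finset.mul_sum]
  exact mul_nonneg (mul_nonneg (softmax_nonneg _ i) (softmax_nonneg _ j)) (h i j)

theorem integrable_logSumExp (c : T → κ → ℝ) :
    Integrable (fun x => logSumExp fun i => c i ⬝ᵥ x) (gaussianPi κ) := by
  refine Integrable.mono' (g := fun x => ∑ i, |c i ⬝ᵥ x| + Real.log (Fintype.card T)) ?_
    (continuous_logSumExp.comp (continuous_dotProduct_family c)).aestronglyMeasurable
    (ae_of_all _ fun x => abs_logSumExp_le _)
  exact (integrable_finsetSum _ fun i _ => (integrable_dotProduct_gaussianPi (c i)).abs).add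
    (integrable_const _)

/-- Comparison of log-sum-exp functionals of two independent Gaussian processes. -/
theorem integral_logSumExp_le (a b : T → κ → ℝ) (horth : ∀ i j, a i ⬝ᵥ b j = 0)
    (hinc : ∀ i j, ∑ k, (a i k - a j k) ^ 2 ≤ ∑ k, (b i k - b j k) ^ 2) :
    ∫ x, logSumExp (fun i => a i ⬝ᵥ x) ∂gaussianPi κ ≤
      ∫ x, logSumExp (fun i => b i ⬝ᵥ x) ∂gaussianPi κ := by
  -- The rotation runs from `a` at `θ = 0` to `b` at `θ = π / 2`, and `d` is its derivative in `θ`.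
  set c : ℝ → T → κ → ℝ := fun θ i => Real.cos θ • a i + Real.sin θ • b i with hc
  set d : ℝ → T → κ → ℝ := fun θ i => -Real.sin θ • a i + Real.cos θ • b i with hd
  have hder : ∀ θ, HasDerivAt (fun θ => ∫ x, logSumExp (fun i => c θ i ⬝ᵥ x) ∂gaussianPi κ)
      (∫ x, ∑ i, softmax (fun j => c θ j ⬝ᵥ x) i * (d θ i ⬝ᵥ x) ∂gaussianPi κ) θ := by
    intro θ
    refine (hasDerivAt_integral_of_dominated_loc_of_deriv_le
      (F := fun θ x => logSumExp (fun i => c θ i ⬝ᵥ x))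
      (F' := fun θ x => ∑ i, softmax (fun j => c θ j ⬝ᵥ x) i * (d θ i ⬝ᵥ x))
      (bound := fun x => ∑ i, (|a i ⬝ᵥ x| + |b i ⬝ᵥ x|)) Filter.univ_mem
      (Filter.Eventually.of_forall fun η => (integrable_logSumExp (c η)).aestronglyMeasurable)
      (integrable_logSumExp (c θ))
      (integrable_finsetSum _ fun i _ => integrable_softmax_mul
        (integrable_dotProduct_gaussianPi (d θ i)) (c θ) i).aestronglyMeasurable
      (ae_of_all _ fun x η _ => ?_)
      (integrable_finsetSum _ fun i _ => (integrable_dotProduct_gaussianPi (a i)).abs.add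
        (integrable_dotProduct_gaussianPi (b i)).abs)
      (ae_of_all _ fun x η _ => hasDerivAt_logSumExp fun i => ?_)).2
    -- Softmax weights, sine and cosine are at most 1 in absolute value, so the bound is uniform in
    -- `θ`.
    · refine (Finset.abs_sum_le_sum_abs _ _).trans (Finset.sum_le_sum fun i _ => ?_)
      rw [abs_mul]
      refine (mul_le_of_le_one_left (abs_nonneg _) (abs_softmax_le_one _ i)).trans ?_
      simp only [hd, add_dotProduct, smul_dotProduct, smul_eq_mul]
      refine (abs_add_le _ _).trans (add_le_add ?_ ?_) <;> rw [abs_mul]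
      · exact mul_le_of_le_one_left (abs_nonneg _) (by rw [abs_neg]; exact Real.abs_sin_le_one _)
      · exact mul_le_of_le_one_left (abs_nonneg _) (Real.abs_cos_le_one _)
    · simp only [hc, hd, add_dotProduct, smul_dotProduct, smul_eq_mul]
      exact ((Real.hasDerivAt_cos η).mul_const _).add ((Real.hasDerivAt_sin η).mul_const _)
  have hpos : ∀ θ ∈ interior (Set.Icc 0 (Real.pi / 2)),
      0 ≤ deriv (fun θ => ∫ x, logSumExp (fun i => c θ i ⬝ᵥ x) ∂gaussianPi κ) θ := by
    intro θ hθ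
    rw [interior_Icc] at hθ
    rw [(hder θ).deriv]
    refine integral_softmax_mul_dotProduct_nonneg _ _ fun i j => ?_
    have horth' : ∑ k, (a i k - a j k) * (b i k - b j k) = 0 := by
      have : (a i - a j) ⬝ᵥ (b i - b j) = 0 := by
        simp [sub_dotProduct, dotProduct_sub, horth]
      exact this
    -- This is half the derivative of `‖c θ i - c θ j‖²`; orthogonality removes the mixed term.
    have : ∑ k, (d θ i k - d θ j k) * (c θ i k - c θ j k) =
        Real.sin θ * Real.cos θ *
          (∑ k, (b i k - b j k) ^ 2 - ∑ k, (a i k - a j k) ^ 2) +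
        (Real.cos θ ^ 2 - Real.sin θ ^ 2) * ∑ k, (a i k - a j k) * (b i k - b j k) := by
      rw [← Finset.sum_sub_distrib, Finset.mul_sum, Finset.mul_sum, ← Finset.sum_add_distrib]
      refine Finset.sum_congr rfl fun k _ => ?_
      simp only [hc, hd, Pi.add_apply, Pi.smul_apply, smul_eq_mul]
      ring
    rw [this, horth', mul_zero, add_zero]
    exact mul_nonneg (mul_nonneg
      (Real.sin_nonneg_of_nonneg_of_le_pi hθ.1.le (by linarith [hθ.2, Real.pi_pos]))
      (Real.cos_nonneg_of_neg_pi_div_two_le_of_le (by linarith [hθ.1, Real.pi_pos]) hθ.2.le))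
      (sub_nonneg.2 (hinc i j))
  have hmono := monotoneOn_of_deriv_nonneg (convex_Icc 0 (Real.pi / 2))
    (fun θ _ => (hder θ).continuousAt.continuousWithinAt)
    (fun θ _ => (hder θ).differentiableAt.differentiableWithinAt) hpos
  have := hmono (Set.left_mem_Icc.2 Real.pi_div_two_pos.le)
    (Set.right_mem_Icc.2 Real.pi_div_two_pos.le) Real.pi_div_two_pos.le
  simpa [hc] using this

theorem integrable_sup'_dotProduct (c : T → κ → ℝ) :
    Integrable (fun x => Finset.univ.sup' Finset.univ_nonempty fun i => c i ⬝ᵥ x)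
      (gaussianPi κ) := by
  refine Integrable.mono' (g := fun x => ∑ i, |c i ⬝ᵥ x|)
    (integrable_finsetSum _ fun i _ => (integrable_dotProduct_gaussianPi (c i)).abs) ?_
    (ae_of_all _ fun x => ?_)
  · refine Continuous.aestronglyMeasurable (Continuous.finset_sup'_apply _ fun i _ => ?_)
    unfold dotProduct; fun_prop
  · obtain ⟨i, -, hi⟩ := Finset.exists_mem_eq_sup' Finset.univ_nonempty fun i => c i ⬝ᵥ x
    rw [hi]
    exact Finset.single_le_sum (f := fun i => |c i ⬝ᵥ x|) (fun j _ => abs_nonneg _)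
      (Finset.mem_univ i)

/-- The Sudakov-Fernique inequality for finite independent Gaussian processes. -/
theorem integral_sup'_le_of_increments (a b : T → κ → ℝ) (horth : ∀ i j, a i ⬝ᵥ b j = 0)
    (hinc : ∀ i j, ∑ k, (a i k - a j k) ^ 2 ≤ ∑ k, (b i k - b j k) ^ 2) :
    ∫ x, Finset.univ.sup' Finset.univ_nonempty (fun i => a i ⬝ᵥ x) ∂gaussianPi κ ≤
      ∫ x, Finset.univ.sup' Finset.univ_nonempty (fun i => b i ⬝ᵥ x) ∂gaussianPi κ := by
  set L := Real.log (Fintype.card T)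
  have hL : 0 ≤ L := Real.log_natCast_nonneg _
  -- Scaling both processes by `β` costs only the fixed error `L`, which vanishes relative to `β` as
  -- `β → ∞`.
  have key : ∀ β : ℝ, 0 < β →
      β * ∫ x, Finset.univ.sup' Finset.univ_nonempty (fun i => a i ⬝ᵥ x) ∂gaussianPi κ ≤
      β * (∫ x, Finset.univ.sup' Finset.univ_nonempty (fun i => b i ⬝ᵥ x) ∂gaussianPi κ) + L := by
    intro β hβ
    calc β * ∫ x, Finset.univ.sup' Finset.univ_nonempty (fun i => a i ⬝ᵥ x) ∂gaussianPi κ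
        ≤ ∫ x, logSumExp (fun i => (β • a i) ⬝ᵥ x) ∂gaussianPi κ := by
          rw [← integral_const_mul]
          refine integral_mono ((integrable_sup'_dotProduct a).const_mul β)
            (integrable_logSumExp fun i => β • a i) fun x => ?_
          obtain ⟨i, -, hi⟩ := Finset.exists_mem_eq_sup' Finset.univ_nonempty fun i => a i ⬝ᵥ x
          simp only [hi]
          simpa [smul_dotProduct] using le_logSumExp (fun i => (β • a i) ⬝ᵥ x) i
      _ ≤ ∫ x, logSumExp (fun i => (β • b i) ⬝ᵥ x) ∂gaussianPi κ := by
          refine integral_logSumExp_le _ _ (fun i j => ?_) fun i j => ?_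
          · simp [smul_dotProduct, dotProduct_smul, horth]
          · simp only [Pi.smul_apply, smul_eq_mul, ← mul_sub, mul_pow, ← Finset.mul_sum]
            exact mul_le_mul_of_nonneg_left (hinc i j) (sq_nonneg β)
      _ ≤ ∫ x, (β * Finset.univ.sup' Finset.univ_nonempty (fun i => b i ⬝ᵥ x) + L)
            ∂gaussianPi κ := by
          refine integral_mono (integrable_logSumExp fun i => β • b i)
            (((integrable_sup'_dotProduct b).const_mul β).add (integrable_const L)) fun x => ?_
          refine logSumExp_le fun i => ?_
          rw [smul_dotProduct, smul_eq_mul]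
          exact mul_le_mul_of_nonneg_left
            (Finset.le_sup' (fun i => b i ⬝ᵥ x) (Finset.mem_univ i)) hβ.le
      _ = _ := by
          rw [integral_add ((integrable_sup'_dotProduct b).const_mul β) (integrable_const L),
            integral_const_mul]
          simp
  refine le_of_forall_pos_le_add fun ε hε => ?_
  -- This `β` makes `L / β ≤ ε`; the `+ 1` keeps it positive when `L = 0`.
  have := key ((L + 1) / ε) (by positivity)
  have h2 : ε * (L + 1)⁻¹ * L ≤ ε := by
    rw [mul_assoc]
    exact mul_le_of_le_one_right hε.le (by rw [inv_mul_le_one₀ (by positivity)]; linarith)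
  have h3 := mul_le_mul_of_nonneg_left this (show 0 ≤ ε * (L + 1)⁻¹ by positivity)
  have h4 : ε * (L + 1)⁻¹ * ((L + 1) / ε) = 1 := by field_simp
  rw [mul_add, ← mul_assoc, ← mul_assoc, h4, one_mul, one_mul] at h3
  linarith

end GaussianWidth

/-! ### Chevet's inequality and the operator norm of a Gaussian matrix. -/

namespace GaussianWidth

theorem integral_coord_sq_gaussianPi {κ : Type*} [Fintype κ] (k : κ) :
    Integrable (fun x : κ → ℝ => x k ^ 2) (gaussianPi κ) ∧
      ∫ x, x k ^ 2 ∂gaussianPi κ = 1 := by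
  have hm := measurePreserving_eval_gaussianPi k
  have hi : Integrable (fun t : ℝ => t ^ 2) (gaussianReal 0 1) :=
    (memLp_id_gaussianReal (μ := 0) (v := 1) 2).integrable_sq
  have hv := variance_fun_id_gaussianReal (μ := 0) (v := 1)
  rw [variance_of_integral_eq_zero (by fun_prop) integral_id_gaussianReal] at hv
  refine ⟨hm.integrable_comp_of_integrable hi, ?_⟩
  rw [← integral_map (φ := fun x : κ → ℝ => x k) (f := fun t : ℝ => t ^ 2)
    hm.measurable.aemeasurable (by fun_prop), hm.map_eq]
  simpa using hv

/-- Cauchy-Schwarz followed by AM-GM. The right side is quadratic in `g`, and its Gaussian mean is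
exactly `√(card ι)`, so no moment of `‖g‖` other than the second is needed. -/
theorem dotProduct_le_of_sum_sq_eq_one {ι : Type*} [Fintype ι] [Nonempty ι] {u : ι → ℝ}
    (hu : ∑ i, u i ^ 2 = 1) (g : ι → ℝ) :
    ∑ i, u i * g i ≤
      ((∑ i, g i ^ 2) / √(Fintype.card ι) + √(Fintype.card ι)) / 2 := by
  set s := √(Fintype.card ι : ℝ)
  have hs : 0 < s := Real.sqrt_pos.2 (by exact_mod_cast Fintype.card_pos)
  have h1 : (∑ i, u i * g i) ^ 2 ≤ ∑ i, g i ^ 2 := by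
    simpa [hu] using Finset.sum_mul_sq_le_sq_mul_sq Finset.univ u g
  have h2 : (∑ i, u i * g i) ≤ ((∑ i, u i * g i) ^ 2 / s + s) / 2 := by
    have : 0 ≤ ((∑ i, u i * g i) - s) ^ 2 / s := by positivity
    have e : ((∑ i, u i * g i) - s) ^ 2 / s =
      (∑ i, u i * g i) ^ 2 / s - 2 * (∑ i, u i * g i) + s := by field_simp; ring
    linarith
  refine h2.trans ?_
  gcongr

theorem sum_sub_sq_of_unit {ι : Type*} [Fintype ι] {x y : ι → ℝ} (hx : ∑ i, x i ^ 2 = 1)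
    (hy : ∑ i, y i ^ 2 = 1) : ∑ i, (x i - y i) ^ 2 = 2 - 2 * ∑ i, x i * y i := by
  have : ∀ i, (x i - y i) ^ 2 = x i ^ 2 + y i ^ 2 - 2 * (x i * y i) := fun i => by ring
  simp only [this, Finset.sum_sub_distrib, Finset.sum_add_distrib, hx, hy, ← Finset.mul_sum]
  ring

theorem sum_mul_le_one_of_unit {ι : Type*} [Fintype ι] {x y : ι → ℝ} (hx : ∑ i, x i ^ 2 = 1)
    (hy : ∑ i, y i ^ 2 = 1) : ∑ i, x i * y i ≤ 1 := by
  have := sum_sub_sq_of_unit hx hy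
  have h0 : 0 ≤ ∑ i, (x i - y i) ^ 2 := Finset.sum_nonneg fun i _ => sq_nonneg _
  linarith

theorem integral_amgm_gaussianPi {κ σ : Type*} [Fintype κ] [Fintype σ] [Nonempty σ] (e : σ → κ) :
    Integrable (fun x : κ → ℝ =>
      ((∑ i, x (e i) ^ 2) / √(Fintype.card σ) + √(Fintype.card σ)) / 2) (gaussianPi κ) ∧
    ∫ x, ((∑ i, x (e i) ^ 2) / √(Fintype.card σ) + √(Fintype.card σ)) / 2 ∂gaussianPi κ =
      √(Fintype.card σ) := by
  have h1 : Integrable (fun x : κ → ℝ => ∑ i, x (e i) ^ 2) (gaussianPi κ) :=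
    integrable_finsetSum _ fun i _ => (integral_coord_sq_gaussianPi (e i)).1
  have h2 := h1.div_const √(Fintype.card σ : ℝ)
  refine ⟨(h2.add (integrable_const _)).div_const 2, ?_⟩
  rw [integral_div, integral_add h2 (integrable_const _), integral_div,
    integral_finsetSum _ fun i _ => (integral_coord_sq_gaussianPi (e i)).1]
  simp [integral_coord_sq_gaussianPi]

/-- Chevet's inequality for a finite family of pairs of unit vectors. -/
theorem integral_sup'_bilinear_le {ι τ T : Type*} [Fintype ι] [Fintype τ] [Nonempty ι] [Nonempty τ]
    [Fintype T] [Nonempty T] (u : T → ι → ℝ) (v : T → τ → ℝ)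
    (hu : ∀ a, ∑ i, u a i ^ 2 = 1) (hv : ∀ a, ∑ j, v a j ^ 2 = 1) :
    ∫ x, Finset.univ.sup' Finset.univ_nonempty
        (fun a : T => ∑ p : ι × τ, u a p.1 * v a p.2 * x (.inl p))
        ∂gaussianPi ((ι × τ) ⊕ (ι ⊕ τ)) ≤
      √(Fintype.card ι) + √(Fintype.card τ) := by
  -- One Gaussian vector carries the matrix `G` and the two vectors `g`, `h` in separate blocks;
  -- disjoint supports make the two processes independent.
  set a : T → (ι × τ) ⊕ (ι ⊕ τ) → ℝ := fun t => Sum.elim (fun p => u t p.1 * v t p.2) 0 with ha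
  set b : T → (ι × τ) ⊕ (ι ⊕ τ) → ℝ := fun t => Sum.elim 0 (Sum.elim (u t) (v t)) with hb
  have hab : ∀ i j, a i ⬝ᵥ b j = 0 := fun i j => by
    simp [ha, hb, dotProduct, Fintype.sum_sum_type]
  have hinc : ∀ i j, ∑ k, (a i k - a j k) ^ 2 ≤ ∑ k, (b i k - b j k) ^ 2 := by
    intro s t
    simp only [ha, hb, Fintype.sum_sum_type, Sum.elim_inl, Sum.elim_inr, Pi.zero_apply, sub_self,
      ne_eq, OfNat.ofNat_ne_zero, not_false_eq_true, zero_pow, Finset.sum_const_zero, add_zero,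
      zero_add]
    have tensor : ∀ x x' : ι → ℝ, ∀ y y' : τ → ℝ,
        ∑ p : ι × τ, (x p.1 * y p.2) * (x' p.1 * y' p.2) =
          (∑ i, x i * x' i) * ∑ j, y j * y' j := fun x x' y y' => by
      rw [Finset.sum_mul_sum, Fintype.sum_prod_type]
      exact Finset.sum_congr rfl fun i _ => Finset.sum_congr rfl fun j _ => by ring
    have unit : ∀ r : T, ∑ p : ι × τ, (u r p.1 * v r p.2) ^ 2 = 1 := fun r => by
      have := tensor (u r) (u r) (v r) (v r)
      simpa only [← pow_two, hu, hv, one_pow] using this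
    rw [sum_sub_sq_of_unit (unit s) (unit t), sum_sub_sq_of_unit (hu s) (hu t),
      sum_sub_sq_of_unit (hv s) (hv t), tensor]
    -- With `α = ⟨u, u'⟩` and `β = ⟨v, v'⟩`, the difference is `(4 - 2α - 2β) - (2 - 2αβ) = 2(1 -
    -- α)(1 - β)`.
    nlinarith [mul_nonneg (sub_nonneg.2 (sum_mul_le_one_of_unit (hu s) (hu t)))
      (sub_nonneg.2 (sum_mul_le_one_of_unit (hv s) (hv t)))]
  have hA : ∀ (x : (ι × τ) ⊕ (ι ⊕ τ) → ℝ) (t : T), a t ⬝ᵥ x =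
      ∑ p : ι × τ, u t p.1 * v t p.2 * x (.inl p) := fun x t => by
    simp [ha, dotProduct, Fintype.sum_sum_type]
  have hmain := integral_sup'_le_of_increments a b hab hinc
  simp only [hA] at hmain
  refine hmain.trans ?_
  have hι := integral_amgm_gaussianPi (κ := (ι × τ) ⊕ (ι ⊕ τ)) fun i : ι => .inr (.inl i)
  have hτ := integral_amgm_gaussianPi (κ := (ι × τ) ⊕ (ι ⊕ τ)) fun j : τ => .inr (.inr j)
  rw [← hι.2, ← hτ.2, ← integral_add hι.1 hτ.1]
  refine integral_mono (integrable_sup'_dotProduct b) (hι.1.add hτ.1) fun x => ?_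
  refine Finset.sup'_le _ _ fun t _ => ?_
  have : b t ⬝ᵥ x =
      ∑ i, u t i * x (.inr (.inl i)) + ∑ j, v t j * x (.inr (.inr j)) := by
    simp [hb, dotProduct, Fintype.sum_sum_type]
  rw [this]
  exact add_le_add (dotProduct_le_of_sum_sq_eq_one (hu t) _)
    (dotProduct_le_of_sum_sq_eq_one (hv t) _)

/-- Selecting part of the coordinates of a Gaussian vector gives a standard Gaussian vector. -/
theorem measurePreserving_toLp_inl_gaussianPi (ι ι' : Type*) [Fintype ι] [Fintype ι'] :
    MeasurePreserving (fun x : ι ⊕ ι' → ℝ => WithLp.toLp 2 fun p => x (.inl p))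
      (gaussianPi (ι ⊕ ι')) (stdGaussian (EuclideanSpace ℝ ι)) := by
  have h1 : MeasurePreserving (WithLp.toLp 2 : (ι → ℝ) → EuclideanSpace ℝ ι)
      (gaussianPi ι) (stdGaussian (EuclideanSpace ℝ ι)) :=
    ⟨by fun_prop, map_pi_eq_stdGaussian⟩
  have h2 : MeasurePreserving (MeasurableEquiv.sumPiEquivProdPi fun _ : ι ⊕ ι' => ℝ)
      (gaussianPi (ι ⊕ ι')) ((gaussianPi ι).prod (gaussianPi ι')) :=
    measurePreserving_sumPiEquivProdPi _
  exact h1.comp (measurePreserving_fst.comp h2)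

/-- The operator between Euclidean spaces defined by a vectorized matrix. -/
noncomputable def vecToCLM (d₁ d₂ : ℕ) : EuclideanSpace ℝ (Fin d₁ × Fin d₂) →ₗ[ℝ]
    EuclideanSpace ℝ (Fin d₂) →L[ℝ] EuclideanSpace ℝ (Fin d₁) where
  toFun g := (Matrix.toEuclideanLin (Matrix.of fun i j => g (i, j))).toContinuousLinearMap
  map_add' g h := by
    ext x i; simp [Matrix.toLpLin_apply, Matrix.mulVec, dotProduct, add_mul, Finset.sum_add_distrib]
  map_smul' c g := by
    ext x i; simp [Matrix.toLpLin_apply, Matrix.mulVec, dotProduct, Finset.mul_sum, mul_assoc]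

variable {d₁ d₂ : ℕ}

theorem vecToCLM_apply (g : EuclideanSpace ℝ (Fin d₁ × Fin d₂)) (x : EuclideanSpace ℝ (Fin d₂))
    (i : Fin d₁) : vecToCLM d₁ d₂ g x i = ∑ j, g (i, j) * x j := rfl

theorem inner_vecToCLM (g : EuclideanSpace ℝ (Fin d₁ × Fin d₂)) (u : EuclideanSpace ℝ (Fin d₁))
    (v : EuclideanSpace ℝ (Fin d₂)) :
    inner ℝ u (vecToCLM d₁ d₂ g v) = ∑ p : Fin d₁ × Fin d₂, u p.1 * v p.2 * g p := by
  simp only [PiLp.inner_apply, vecToCLM_apply, Fintype.sum_prod_type]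
  refine Finset.sum_congr rfl fun i _ => ?_
  simp only [RCLike.inner_apply, conj_trivial, Finset.sum_mul]
  exact Finset.sum_congr rfl fun j _ => by ring

theorem exists_norm_vecToCLM_le (d₁ d₂ : ℕ) :
    ∃ C, 0 ≤ C ∧ ∀ g, ‖vecToCLM d₁ d₂ g‖ ≤ C * ‖g‖ :=
  ⟨‖(vecToCLM d₁ d₂).toContinuousLinearMap‖, ContinuousLinearMap.opNorm_nonneg _,
    (vecToCLM d₁ d₂).toContinuousLinearMap.le_opNorm⟩

theorem integrable_norm_stdGaussian {ι : Type*} [Fintype ι] :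
    Integrable (fun g => ‖g‖) (stdGaussian (EuclideanSpace ℝ ι)) :=
  (IsGaussian.integrable_id (μ := stdGaussian (EuclideanSpace ℝ ι))).norm

theorem integrable_norm_vecToCLM (d₁ d₂ : ℕ) :
    Integrable (fun g => ‖vecToCLM d₁ d₂ g‖) (stdGaussian _) := by
  obtain ⟨C, -, hC⟩ := exists_norm_vecToCLM_le d₁ d₂
  refine (integrable_norm_stdGaussian.const_mul C).mono'
    (vecToCLM d₁ d₂).continuous_of_finiteDimensional.norm.aestronglyMeasurable
    (ae_of_all _ fun g => ?_)
  rw [norm_norm]; exact hC g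

/-- The operator norm is almost attained on a net of pairs of unit vectors. -/
theorem opNorm_le_of_net {E F : Type*} [NormedAddCommGroup E] [InnerProductSpace ℝ E]
    [NormedAddCommGroup F] [InnerProductSpace ℝ F] (A : E →L[ℝ] F) {s : Set E} {t : Set F}
    {ε M : ℝ} (hs : Metric.sphere (0 : E) 1 ⊆ ⋃ v ∈ s, Metric.ball v ε)
    (ht : Metric.sphere (0 : F) 1 ⊆ ⋃ u ∈ t, Metric.ball u ε)
    (hs1 : s ⊆ Metric.sphere 0 1) (ht1 : t ⊆ Metric.sphere 0 1) (hs0 : s.Nonempty)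
    (ht0 : t.Nonempty) (hM : ∀ u ∈ t, ∀ v ∈ s, inner ℝ u (A v) ≤ M) :
    ‖A‖ ≤ M + 2 * ε * ‖A‖ := by
  have key : ∀ (x : E) (y : F), ‖x‖ = 1 → ‖y‖ = 1 → inner ℝ (A x) y ≤ M + 2 * ε * ‖A‖ := by
    intro x y hx hy
    obtain ⟨v, hv, hvx⟩ := Set.mem_iUnion₂.1 (hs (mem_sphere_zero_iff_norm.2 hx))
    obtain ⟨u, hu, huy⟩ := Set.mem_iUnion₂.1 (ht (mem_sphere_zero_iff_norm.2 hy))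
    rw [Metric.mem_ball, dist_eq_norm] at hvx huy
    have hv1 : ‖v‖ = 1 := mem_sphere_zero_iff_norm.1 (hs1 hv)
    -- Replacing `y` by `u` and then `x` by `v` costs at most `ε ‖A‖` each time.
    have e : (inner ℝ (A x) y : ℝ) =
        inner ℝ u (A v) + inner ℝ (y - u) (A v) + inner ℝ y (A (x - v)) := by
      rw [map_sub, inner_sub_left, inner_sub_right, real_inner_comm]; ring
    have b1 : inner ℝ (y - u) (A v) ≤ ε * ‖A‖ := by
      refine (real_inner_le_norm _ _).trans (mul_le_mul huy.le ?_ (norm_nonneg _)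
        ((norm_nonneg _).trans huy.le))
      simpa [hv1] using A.le_opNorm v
    have b2 : inner ℝ y (A (x - v)) ≤ ε * ‖A‖ := by
      refine (real_inner_le_norm _ _).trans ?_
      rw [hy, one_mul, mul_comm]
      exact (A.le_opNorm _).trans (mul_le_mul_of_nonneg_left hvx.le (norm_nonneg _))
    linarith [hM u hu v hv]
  obtain ⟨v, hv⟩ := hs0
  obtain ⟨u, hu⟩ := ht0
  have hv1 := mem_sphere_zero_iff_norm.1 (hs1 hv)
  have hu1 := mem_sphere_zero_iff_norm.1 (ht1 hu)
  -- Adding the bounds for `u` and `-u` shows that `M + 2 ε ‖A‖` is nonnegative, as the operator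
  -- norm criterion requires.
  have h1 := key v u hv1 hu1
  have h2 := key v (-u) hv1 (by rw [norm_neg, hu1])
  rw [inner_neg_right] at h2
  exact A.opNorm_le_of_re_inner_le (by linarith) key

/-- The expected operator norm of a standard Gaussian matrix. -/
theorem integral_norm_vecToCLM_le (d₁ d₂ : ℕ) :
    ∫ g, ‖vecToCLM d₁ d₂ g‖ ∂stdGaussian _ ≤ √(d₁ : ℝ) + √(d₂ : ℝ) := by
  -- In dimension zero the unit sphere is empty and there are no nets, but the matrix vanishes.
  have hdeg : (IsEmpty (Fin d₁) ∨ IsEmpty (Fin d₂)) →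
      ∫ g, ‖vecToCLM d₁ d₂ g‖ ∂stdGaussian _ ≤ √(d₁ : ℝ) + √(d₂ : ℝ) := by
    intro h
    have : ∀ g, vecToCLM d₁ d₂ g = 0 := fun g => by
      have : g = 0 := by
        ext p
        rcases h with h | h
        exacts [h.elim p.1, h.elim p.2]
      rw [this, map_zero]
    simp only [this, norm_zero, integral_zero]
    positivity
  rcases isEmpty_or_nonempty (Fin d₁) with h₁ | h₁
  · exact hdeg (.inl h₁)
  rcases isEmpty_or_nonempty (Fin d₂) with h₂ | h₂
  · exact hdeg (.inr h₂)
  clear hdeg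
  have hN := integrable_norm_vecToCLM d₁ d₂
  set I := ∫ g, ‖vecToCLM d₁ d₂ g‖ ∂stdGaussian _ with hIdef
  -- Chevet's bound does not depend on the size of the nets, so `ε` may tend to 0 once `I` is known
  -- to be finite.
  have key : ∀ ε : ℝ, 0 < ε → I ≤ √(d₁ : ℝ) + √(d₂ : ℝ) + 2 * ε * I := by
    intro ε hε
    obtain ⟨t, ht1, htf, htc⟩ := finite_cover_balls_of_compact
      (isCompact_sphere (0 : EuclideanSpace ℝ (Fin d₁)) 1) hε
    obtain ⟨s, hs1, hsf, hsc⟩ := finite_cover_balls_of_compact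
      (isCompact_sphere (0 : EuclideanSpace ℝ (Fin d₂)) 1) hε
    have hne : ∀ {d : ℕ} {r : Set (EuclideanSpace ℝ (Fin d))}, Nonempty (Fin d) →
        Metric.sphere (0 : EuclideanSpace ℝ (Fin d)) 1 ⊆ ⋃ v ∈ r, Metric.ball v ε →
        r.Nonempty := by
      intro d r ⟨i⟩ hr
      obtain ⟨v, hv, -⟩ := Set.mem_iUnion₂.1
        (hr (show EuclideanSpace.single i (1 : ℝ) ∈ _ by simp))
      exact ⟨v, hv⟩
    have ht0 := hne h₁ htc
    have hs0 := hne h₂ hsc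
    have := ht0.to_subtype
    have := hs0.to_subtype
    have := htf.fintype
    have := hsf.fintype
    have unit : ∀ {d : ℕ} (x : EuclideanSpace ℝ (Fin d)), x ∈ Metric.sphere 0 1 →
        ∑ i, x i ^ 2 = 1 := fun x hx => by
      rw [← EuclideanSpace.real_norm_sq_eq, mem_sphere_zero_iff_norm.1 hx, one_pow]
    have hc := integral_sup'_bilinear_le (T := t × s) (fun a i => a.1.1 i) (fun a j => a.2.1 j)
      (fun a => unit _ (ht1 a.1.2)) (fun a => unit _ (hs1 a.2.2))
    -- Chevet's bound lives on the space enlarged by `g` and `h`; the mean norm is transported there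
    -- along the projection.
    have hmp := measurePreserving_toLp_inl_gaussianPi (Fin d₁ × Fin d₂) (Fin d₁ ⊕ Fin d₂)
    have hN' : Integrable (fun x => ‖vecToCLM d₁ d₂ (WithLp.toLp 2 fun p => x (.inl p))‖)
        (gaussianPi ((Fin d₁ × Fin d₂) ⊕ (Fin d₁ ⊕ Fin d₂))) := hmp.integrable_comp_of_integrable hN
    have hI : I = ∫ x, ‖vecToCLM d₁ d₂ (WithLp.toLp 2 fun p => x (.inl p))‖
        ∂gaussianPi ((Fin d₁ × Fin d₂) ⊕ (Fin d₁ ⊕ Fin d₂)) := by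
      rw [hIdef, ← hmp.map_eq]
      refine integral_map hmp.measurable.aemeasurable ?_
      rw [hmp.map_eq]; exact hN.aestronglyMeasurable
    have hS := integrable_sup'_dotProduct (κ := (Fin d₁ × Fin d₂) ⊕ (Fin d₁ ⊕ Fin d₂)) (T := t × s)
      fun a => Sum.elim (fun p => a.1.1 p.1 * a.2.1 p.2) 0
    simp only [dotProduct, Fintype.sum_sum_type, Sum.elim_inl, Sum.elim_inr, Pi.zero_apply,
      zero_mul, Finset.sum_const_zero, add_zero] at hS
    simp only [Fintype.card_fin] at hc
    refine le_trans ?_ (add_le_add_left hc _)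
    rw [hI, ← integral_const_mul, ← integral_add hS (hN'.const_mul _)]
    refine integral_mono hN' (hS.add (hN'.const_mul _)) fun x => ?_
    refine opNorm_le_of_net _ hsc htc hs1 ht1 hs0 ht0 fun u hu v hv => ?_
    rw [inner_vecToCLM]
    exact Finset.le_sup'
      (fun a : t × s => ∑ p : Fin d₁ × Fin d₂, a.1.1 p.1 * a.2.1 p.2 * x (.inl p))
      (Finset.mem_univ (⟨u, hu⟩, ⟨v, hv⟩))
  refine le_of_forall_pos_le_add fun δ hδ => ?_
  have hI0 : 0 ≤ I := integral_nonneg fun g => norm_nonneg _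
  -- This `ε` gives `2 ε I ≤ δ`; the `+ 1` covers `I = 0`.
  have := key (δ / (2 * (I + 1))) (by positivity)
  have h2 : 2 * (δ / (2 * (I + 1))) * I ≤ δ := by
    rw [show 2 * (δ / (2 * (I + 1))) * I = δ * (I / (I + 1)) by field_simp]
    exact mul_le_of_le_one_right hδ.le (by rw [div_le_one (by positivity)]; linarith)
  linarith

end GaussianWidth

/-! ### Gaussian mean width of bounded sets. -/

namespace GaussianWidth

open scoped Pointwise

section Width

variable {ι : Type*} [Fintype ι] {K : Set (EuclideanSpace ℝ ι)}

theorem bddAbove_range_inner_sub {R : ℝ} (hR : ∀ u ∈ K, ‖u‖ ≤ R) (g : EuclideanSpace ℝ ι) :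
    BddAbove (Set.range fun u : ↥(K - K) => inner ℝ g (u : EuclideanSpace ℝ ι)) := by
  refine ⟨‖g‖ * (R + R), ?_⟩
  rintro _ ⟨⟨_, x, hx, y, hy, rfl⟩, rfl⟩
  exact (real_inner_le_norm _ _).trans (mul_le_mul_of_nonneg_left
    ((norm_sub_le x y).trans (add_le_add (hR x hx) (hR y hy))) (norm_nonneg _))

theorem directionalWidth_nonneg (g : EuclideanSpace ℝ ι) : 0 ≤ directionalWidth K g := by
  rcases K.eq_empty_or_nonempty with rfl | ⟨x, hx⟩
  -- A real supremum over an empty type is 0 by default.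
  · have : IsEmpty ↥((∅ : Set (EuclideanSpace ℝ ι)) - ∅) := by simp
    exact (Real.iSup_of_isEmpty _).ge
  · exact Real.iSup_nonneg' ⟨⟨x - x, Set.sub_mem_sub hx hx⟩, by simp⟩

theorem directionalWidth_le {B : ℝ} {g : EuclideanSpace ℝ ι} (hB : 0 ≤ B)
    (h : ∀ u ∈ K, |inner ℝ g u| ≤ B) : directionalWidth K g ≤ 2 * B := by
  refine Real.iSup_le ?_ (by positivity)
  rintro ⟨_, x, hx, y, hy, rfl⟩
  have h1 := abs_le.1 (h x hx)
  have h2 := abs_le.1 (h y hy)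
  simp only [inner_sub_right]
  linarith

/-- A supremum of linear functionals of norm at most `2R` is `2R`-Lipschitz. Continuity supplies the
measurability that an uncountable supremum need not have. -/
theorem continuous_directionalWidth (hK : Bornology.IsBounded K) :
    Continuous (directionalWidth K) := by
  obtain ⟨R, hR0, hR⟩ := hK.exists_pos_norm_le
  refine (LipschitzWith.of_le_add_mul (Real.toNNReal (R + R)) fun g h => ?_).continuous
  rw [Real.coe_toNNReal _ (by positivity)]
  refine Real.iSup_le (fun u => ?_)
    (add_nonneg (directionalWidth_nonneg h) (mul_nonneg (by positivity) dist_nonneg))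
  have hu : ‖(u : EuclideanSpace ℝ ι)‖ ≤ R + R := by
    obtain ⟨_, x, hx, y, hy, rfl⟩ := u
    exact (norm_sub_le x y).trans (add_le_add (hR x hx) (hR y hy))
  have h1 : inner ℝ h (u : EuclideanSpace ℝ ι) ≤ directionalWidth K h :=
    le_ciSup (bddAbove_range_inner_sub hR h) u
  have h2 : inner ℝ (g - h) (u : EuclideanSpace ℝ ι) ≤ (R + R) * dist g h := by
    rw [dist_eq_norm, mul_comm]
    exact (real_inner_le_norm _ _).trans (mul_le_mul_of_nonneg_left hu (norm_nonneg _))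
  rw [inner_sub_left] at h2
  linarith

theorem integrable_directionalWidth (hK : Bornology.IsBounded K) :
    Integrable (directionalWidth K) (stdGaussian (EuclideanSpace ℝ ι)) := by
  obtain ⟨R, hR0, hR⟩ := hK.exists_pos_norm_le
  refine (integrable_norm_stdGaussian.const_mul (2 * R)).mono'
    (continuous_directionalWidth hK).aestronglyMeasurable (ae_of_all _ fun g => ?_)
  rw [Real.norm_of_nonneg (directionalWidth_nonneg g), mul_assoc]
  refine directionalWidth_le (by positivity) fun u hu => ?_
  rw [mul_comm]
  exact (abs_real_inner_le_norm _ _).trans (mul_le_mul_of_nonneg_left (hR u hu) (norm_nonneg _))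

end Width

variable {d₁ d₂ : ℕ}

/-- A set of matrices on which linear functionals are controlled by the operator norm has small
Gaussian mean width. -/
theorem gaussianMeanWidth_le {K : Set (EuclideanSpace ℝ (Fin d₁ × Fin d₂))}
    (hK : Bornology.IsBounded K) {C : ℝ} (hC : 0 ≤ C)
    (h : ∀ g, ∀ u ∈ K, |inner ℝ g u| ≤ C * ‖vecToCLM d₁ d₂ g‖) :
    gaussianMeanWidth K ≤ 2 * (C * (√(d₁ : ℝ) + √(d₂ : ℝ))) := by
  calc gaussianMeanWidth K ≤ ∫ g, 2 * (C * ‖vecToCLM d₁ d₂ g‖) ∂stdGaussian _ :=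
        integral_mono (integrable_directionalWidth hK)
          (((integrable_norm_vecToCLM d₁ d₂).const_mul C).const_mul 2)
          fun g => directionalWidth_le (by positivity) (h g)
    _ = 2 * (C * ∫ g, ‖vecToCLM d₁ d₂ g‖ ∂stdGaussian _) := by
        rw [integral_const_mul, integral_const_mul]
    _ ≤ _ := by
        have := integral_norm_vecToCLM_le d₁ d₂
        gcongr

/-! ### Singular values and trace duality. -/

section SingularValues

variable {E F : Type*} [NormedAddCommGroup E] [InnerProductSpace ℝ E] [FiniteDimensional ℝ E]
  [NormedAddCommGroup F] [InnerProductSpace ℝ F] [FiniteDimensional ℝ F]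

/-- The Hilbert-Schmidt inner product does not depend on the orthonormal basis. -/
theorem sum_inner_apply_eq {σ σ' : Type*} [Fintype σ] [Fintype σ'] (A B : E →ₗ[ℝ] F)
    (b : OrthonormalBasis σ ℝ E) (b' : OrthonormalBasis σ' ℝ E) :
    ∑ k, inner ℝ (A (b k)) (B (b k)) = ∑ k, inner ℝ (A (b' k)) (B (b' k)) := by
  have h := (A.adjoint ∘ₗ B).trace_eq_sum_inner b
  have h' := (A.adjoint ∘ₗ B).trace_eq_sum_inner b'
  simp only [LinearMap.comp_apply, LinearMap.adjoint_inner_right] at h h'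
  rw [← h, ← h']

/-- The basis consists of right singular vectors: `‖A b‖² = ⟨b, A* A b⟩` is the eigenvalue `s²`.
This replaces a full singular value decomposition. -/
theorem norm_apply_eigenvectorBasis (A : E →ₗ[ℝ] F) {n : ℕ} (hn : Module.finrank ℝ E = n)
    (k : Fin n) :
    ‖A (A.isSymmetric_adjoint_comp_self.eigenvectorBasis hn k)‖ = A.singularValues k := by
  set b := A.isSymmetric_adjoint_comp_self.eigenvectorBasis hn with hb
  rw [← sq_eq_sq₀ (norm_nonneg _) (A.singularValues_nonneg _), A.sq_singularValues_fin hn,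
    ← real_inner_self_eq_norm_sq, ← LinearMap.adjoint_inner_right, ← LinearMap.comp_apply, hb,
    LinearMap.IsSymmetric.apply_eigenvectorBasis, real_inner_smul_right,
    real_inner_self_eq_norm_sq, OrthonormalBasis.norm_eq_one]
  simp

end SingularValues

/-- The Frobenius inner product, computed in an arbitrary orthonormal basis. -/
theorem inner_eq_sum_orthonormalBasis {σ : Type*} [Fintype σ]
    (b : OrthonormalBasis σ ℝ (EuclideanSpace ℝ (Fin d₂)))
    (g h : EuclideanSpace ℝ (Fin d₁ × Fin d₂)) :
    inner ℝ g h = ∑ k, inner ℝ (vecToCLM d₁ d₂ g (b k)) (vecToCLM d₁ d₂ h (b k)) := by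
  have e : ∀ (f : EuclideanSpace ℝ (Fin d₁ × Fin d₂)) (i : Fin d₁) (j : Fin d₂),
      vecToCLM d₁ d₂ f (EuclideanSpace.basisFun (Fin d₂) ℝ j) i = f (i, j) := fun f i j => by
    rw [vecToCLM_apply]; simp
  refine Eq.trans ?_ (sum_inner_apply_eq (vecToCLM d₁ d₂ g).toLinearMap
    (vecToCLM d₁ d₂ h).toLinearMap b (EuclideanSpace.basisFun (Fin d₂) ℝ)).symm
  simp only [ContinuousLinearMap.coe_coe, PiLp.inner_apply, e, Fintype.sum_prod_type_right]

theorem norm_vecToCLM_vectorize_eigenvectorBasis (X : Matrix (Fin d₁) (Fin d₂) ℝ) (k : Fin d₂) :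
    ‖vecToCLM d₁ d₂ (vectorize X) ((Matrix.toEuclideanLin X).isSymmetric_adjoint_comp_self
      |>.eigenvectorBasis finrank_euclideanSpace_fin k)‖ =
      (Matrix.toEuclideanLin X).singularValues k :=
  norm_apply_eigenvectorBasis (Matrix.toEuclideanLin X) finrank_euclideanSpace_fin k

theorem finrank_range_toEuclideanLin (X : Matrix (Fin d₁) (Fin d₂) ℝ) :
    Module.finrank ℝ (Matrix.toEuclideanLin X).range = X.rank := by
  rw [X.rank_eq_finrank_range_toLin (PiLp.basisFun 2 ℝ _) (PiLp.basisFun 2 ℝ _),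
    ← Matrix.toLpLin_eq_toLin]

theorem singularValues_eq_zero_of_rank_le {X : Matrix (Fin d₁) (Fin d₂) ℝ} {k : ℕ}
    (h : X.rank ≤ k) : (Matrix.toEuclideanLin X).singularValues k = 0 := by
  rwa [LinearMap.singularValues_eq_zero_iff_le_finrank_range, finrank_range_toEuclideanLin]

/-- The singular values beyond the rank do not contribute to sums. -/
theorem sum_singularValues_eq_sum_rank (X : Matrix (Fin d₁) (Fin d₂) ℝ) {n : ℕ}
    (hn : X.rank ≤ n) {f : ℝ → ℝ} (hf : f 0 = 0) :
    ∑ k ∈ Finset.range n, f ((Matrix.toEuclideanLin X).singularValues k) =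
      ∑ k ∈ Finset.range X.rank, f ((Matrix.toEuclideanLin X).singularValues k) := by
  refine (Finset.sum_subset (Finset.range_mono hn) fun k _ hk => ?_).symm
  rw [singularValues_eq_zero_of_rank_le (by simpa using hk), hf]

theorem nuclearNorm_eq_sum_rank (X : Matrix (Fin d₁) (Fin d₂) ℝ) :
    nuclearNorm X = ∑ k ∈ Finset.range X.rank, (Matrix.toEuclideanLin X).singularValues k :=
  sum_singularValues_eq_sum_rank X (le_min X.rank_le_height X.rank_le_width) (f := id) rfl

/-- The eigenbasis of `XᵀX` has `d₂` vectors rather than `min d₁ d₂`; the surplus singular values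
are zero. -/
theorem nuclearNorm_eq_sum_range (X : Matrix (Fin d₁) (Fin d₂) ℝ) :
    nuclearNorm X = ∑ k ∈ Finset.range d₂, (Matrix.toEuclideanLin X).singularValues k :=
  (nuclearNorm_eq_sum_rank X).trans
    (sum_singularValues_eq_sum_rank X X.rank_le_width (f := id) rfl).symm

/-- In the right singular basis `b` of `X`, the inner product is `∑ ⟨G b_k, X b_k⟩`, and each term
is at most `‖G‖ s_k`. -/
theorem abs_inner_vectorize_le (g : EuclideanSpace ℝ (Fin d₁ × Fin d₂))
    (X : Matrix (Fin d₁) (Fin d₂) ℝ) :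
    |inner ℝ g (vectorize X)| ≤ nuclearNorm X * ‖vecToCLM d₁ d₂ g‖ := by
  rw [inner_eq_sum_orthonormalBasis ((Matrix.toEuclideanLin X).isSymmetric_adjoint_comp_self
    |>.eigenvectorBasis finrank_euclideanSpace_fin), nuclearNorm_eq_sum_range, Finset.sum_range,
    Finset.sum_mul]
  refine (Finset.abs_sum_le_sum_abs _ _).trans (Finset.sum_le_sum fun k _ => ?_)
  refine (abs_real_inner_le_norm _ _).trans ?_
  rw [mul_comm, norm_vecToCLM_vectorize_eigenvectorBasis]
  refine mul_le_mul_of_nonneg_left ?_ (LinearMap.singularValues_nonneg _ _)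
  refine (ContinuousLinearMap.le_opNorm _ _).trans ?_
  rw [OrthonormalBasis.norm_eq_one, mul_one]

theorem norm_vectorize_sq (X : Matrix (Fin d₁) (Fin d₂) ℝ) :
    ‖vectorize X‖ ^ 2 = ∑ k ∈ Finset.range d₂, (Matrix.toEuclideanLin X).singularValues k ^ 2 := by
  rw [← real_inner_self_eq_norm_sq, inner_eq_sum_orthonormalBasis
    ((Matrix.toEuclideanLin X).isSymmetric_adjoint_comp_self
    |>.eigenvectorBasis finrank_euclideanSpace_fin), Finset.sum_range]
  refine Finset.sum_congr rfl fun k _ => ?_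
  rw [real_inner_self_eq_norm_sq, norm_vecToCLM_vectorize_eigenvectorBasis]

theorem frobeniusNorm_eq (X : Matrix (Fin d₁) (Fin d₂) ℝ) : frobeniusNorm X = ‖vectorize X‖ := by
  simp [frobeniusNorm, EuclideanSpace.norm_eq, vectorize, Fintype.sum_prod_type]

/-- Cauchy-Schwarz over the first `X.rank` singular values, whose squares sum to the squared
Frobenius norm. -/
theorem nuclearNorm_le_sqrt_rank_mul (X : Matrix (Fin d₁) (Fin d₂) ℝ) :
    nuclearNorm X ≤ √(X.rank : ℝ) * frobeniusNorm X := by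
  rw [frobeniusNorm_eq, nuclearNorm_eq_sum_rank]
  refine le_of_sq_le_sq (sq_sum_le_card_mul_sum_sq.trans_eq ?_) (by positivity)
  rw [mul_pow, Real.sq_sqrt (Nat.cast_nonneg _), norm_vectorize_sq, Finset.card_range,
    sum_singularValues_eq_sum_rank X X.rank_le_width (f := fun s => s ^ 2) (by simp)]

theorem isBounded_nuclearUnitBall : Bornology.IsBounded (nuclearUnitBall d₁ d₂) := by
  obtain ⟨C, hC0, hC⟩ := exists_norm_vecToCLM_le d₁ d₂
  refine isBounded_iff_forall_norm_le.2 ⟨C, ?_⟩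
  rintro _ ⟨X, hX, rfl⟩
  -- Testing duality on `X` itself gives `‖X‖² ≤ ‖X‖_* ‖X‖_op ≤ C ‖X‖`.
  have h := abs_inner_vectorize_le (vectorize X) X
  rw [real_inner_self_eq_norm_sq, abs_of_nonneg (by positivity)] at h
  have h2 : ‖vectorize X‖ ^ 2 ≤ C * ‖vectorize X‖ :=
    h.trans ((mul_le_of_le_one_left (norm_nonneg _) hX).trans (hC _))
  by_contra! hlt
  nlinarith

theorem isBounded_lowRankUnitSphere (r : ℕ) :
    Bornology.IsBounded (lowRankUnitSphere d₁ d₂ r) := by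
  refine isBounded_iff_forall_norm_le.2 ⟨1, ?_⟩
  rintro _ ⟨X, hX, rfl⟩
  rw [← frobeniusNorm_eq, hX.1]

theorem gaussianMeanWidth_nuclearUnitBall_le (d₁ d₂ : ℕ) :
    gaussianMeanWidth (nuclearUnitBall d₁ d₂) ≤ 2 * (√(d₁ : ℝ) + √(d₂ : ℝ)) := by
  have := gaussianMeanWidth_le (isBounded_nuclearUnitBall (d₁ := d₁) (d₂ := d₂)) zero_le_one ?_
  · rwa [one_mul] at this
  · rintro g _ ⟨X, hX, rfl⟩
    exact (abs_inner_vectorize_le g X).trans (mul_le_mul_of_nonneg_right hX (norm_nonneg _))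

theorem gaussianMeanWidth_lowRankUnitSphere_le (d₁ d₂ r : ℕ) :
    gaussianMeanWidth (lowRankUnitSphere d₁ d₂ r) ≤
      2 * √(2 * (r : ℝ) * ((d₁ : ℝ) + (d₂ : ℝ))) := by
  refine (gaussianMeanWidth_le (isBounded_lowRankUnitSphere r) (C := √(r : ℝ)) (by positivity)
    ?_).trans ?_
  · rintro g _ ⟨X, ⟨hX, hr⟩, rfl⟩
    refine (abs_inner_vectorize_le g X).trans (mul_le_mul_of_nonneg_right ?_ (norm_nonneg _))
    refine (nuclearNorm_le_sqrt_rank_mul X).trans ?_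
    rw [hX, mul_one]
    exact Real.sqrt_le_sqrt (by exact_mod_cast hr)
  -- After squaring, this is `(√d₁ + √d₂)² ≤ 2 (d₁ + d₂)`.
  · refine mul_le_mul_of_nonneg_left (Real.le_sqrt_of_sq_le ?_) zero_le_two
    have h1 := Real.sq_sqrt (Nat.cast_nonneg (α := ℝ) d₁)
    have h2 := Real.sq_sqrt (Nat.cast_nonneg (α := ℝ) d₂)
    rw [mul_pow, Real.sq_sqrt (Nat.cast_nonneg r), mul_comm (2 : ℝ), mul_assoc]
    refine mul_le_mul_of_nonneg_left ?_ (Nat.cast_nonneg r)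
    nlinarith [sq_nonneg (√(d₁ : ℝ) - √(d₂ : ℝ))]

end GaussianWidth

theorem mainTheorem8 (d₁ d₂ : ℕ) :
    (Bornology.IsBounded (GaussianWidth.nuclearUnitBall d₁ d₂) ∧
      MeasureTheory.Integrable
        (GaussianWidth.directionalWidth (GaussianWidth.nuclearUnitBall d₁ d₂))
        (ProbabilityTheory.stdGaussian (EuclideanSpace ℝ (Fin d₁ × Fin d₂))) ∧
      GaussianWidth.gaussianMeanWidth (GaussianWidth.nuclearUnitBall d₁ d₂) ≤
        2 * (Real.sqrt (d₁ : ℝ) + Real.sqrt (d₂ : ℝ))) ∧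
    ∀ r : ℕ,
      Bornology.IsBounded (GaussianWidth.lowRankUnitSphere d₁ d₂ r) ∧
      MeasureTheory.Integrable
        (GaussianWidth.directionalWidth (GaussianWidth.lowRankUnitSphere d₁ d₂ r))
        (ProbabilityTheory.stdGaussian (EuclideanSpace ℝ (Fin d₁ × Fin d₂))) ∧
      GaussianWidth.gaussianMeanWidth (GaussianWidth.lowRankUnitSphere d₁ d₂ r) ≤
        2 * Real.sqrt (2 * (r : ℝ) * ((d₁ : ℝ) + (d₂ : ℝ))) :=
  ⟨⟨GaussianWidth.isBounded_nuclearUnitBall,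
    GaussianWidth.integrable_directionalWidth GaussianWidth.isBounded_nuclearUnitBall,
    GaussianWidth.gaussianMeanWidth_nuclearUnitBall_le d₁ d₂⟩,
  fun r => ⟨GaussianWidth.isBounded_lowRankUnitSphere r,
    GaussianWidth.integrable_directionalWidth (GaussianWidth.isBounded_lowRankUnitSphere r),
    GaussianWidth.gaussianMeanWidth_lowRankUnitSphere_le d₁ d₂ r⟩⟩
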